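/- Let $k$ be an arbitrary field and let $K$ be the field of (generalized) Puiseux series over $k$, i.e. of formal series $\sum_{q\in A}\xi_q t^q$ with $\xi_q\in k$ and $A\subset\mathbb{Q}$ well-ordered, with the valuation $\operatorname{val}$ that sends a nonzero series to its least exponent. Let $f\in K[z_1,\dots,z_n]$ be maximally sparse: every monomial that occurs in $f$ with a nonzero coefficient corresponds to a vertex of the Newton polytope of $f$ (the convex hull in $\mathbb{R}^n$ of the exponents of its monomials). Let $V=\{z\in(K\setminus\{0\})^n : f(z)=0\}$, and let $\mathcal{A}(V)\subset\mathbb{R}^n$ be its non-Archimedean amoeba, i.e. the closure of the image of $V$ under $(z_1,\dots,z_n)\mapsto(-\operatorname{val}(z_1),\dots,-\operatorname{val}(z_n))$. Then $\mathcal{A}(V)$ is solid: every connected component $E$ of $\mathbb{R}^n\setminus\mathcal{A}(V)$ has a full-dimensional recession cone, that is, some translate of a full-dimensional convex cone is contained in $E$. (The recession cone of a convex set is the greatest cone that can be translated into it, so for convex $E$ this says that this greatest cone is full-dimensional.) -/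

import Mathlib

noncomputable section

/-- The field of generalized Puiseux series over `k`: formal series `∑ ξ_q t ^ q` with
coefficients in `k` and rational exponents, the exponents that occur forming a
well-ordered subset of `ℚ`. -/
abbrev Puiseux (k : Type*) [Field k] : Type _ := HahnSeries ℚ k

namespace NonArchAmoeba

/-- The map `(z₁, …, zₙ) ↦ (-val z₁, …, -val zₙ)` on the torus `(K \ {0})ⁿ`. For a nonzero
series, `HahnSeries.order` is the least exponent that occurs in it, i.e. its valuation. -/
def logMap {k : Type*} [Field k] {n : ℕ} (z : Fin n → (Puiseux k)ˣ) : Fin n → ℝ :=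
  fun i => -(((z i : Puiseux k).order : ℚ) : ℝ)

/-- The hypersurface `f = 0` in the torus `(K \ {0})ⁿ`. -/
def hypersurface {k : Type*} [Field k] {n : ℕ} (f : MvPolynomial (Fin n) (Puiseux k)) :
    Set (Fin n → (Puiseux k)ˣ) :=
  {z | MvPolynomial.eval (fun i => (z i : Puiseux k)) f = 0}

/-- The non-Archimedean amoeba of the hypersurface `V` in the torus `(K \ {0})ⁿ`: the
closure of its image under `logMap`. -/
def amoeba {k : Type*} [Field k] {n : ℕ} (V : Set (Fin n → (Puiseux k)ˣ)) :
    Set (Fin n → ℝ) :=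
  closure (logMap '' V)

/-- An exponent vector as a point of `ℝⁿ`. -/
def exponentPoint {n : ℕ} (α : Fin n →₀ ℕ) : Fin n → ℝ := fun i => (α i : ℝ)

/-- The Newton polytope: the convex hull in `ℝⁿ` of the exponents of the monomials of `f`. -/
def newtonPolytope {R : Type*} [CommSemiring R] {n : ℕ} (f : MvPolynomial (Fin n) R) :
    Set (Fin n → ℝ) :=
  convexHull ℝ (exponentPoint '' (f.support : Set (Fin n →₀ ℕ)))

/-- `f` is maximally sparse: every monomial with a nonzero coefficient corresponds to a
vertex of the Newton polytope. -/
def IsMaximallySparse {R : Type*} [CommSemiring R] {n : ℕ} (f : MvPolynomial (Fin n) R) :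
    Prop :=
  ∀ α ∈ f.support, exponentPoint α ∈ Set.extremePoints ℝ (newtonPolytope f)

/-- Some translate of the cone `C` lies in `E`. -/
def TranslatesInto {n : ℕ} (C : PointedCone ℝ (Fin n → ℝ)) (E : Set (Fin n → ℝ)) : Prop :=
  ∃ x : Fin n → ℝ, ∀ v ∈ C, x + v ∈ E

/-- A cone in `ℝⁿ` is full-dimensional if its linear span is `ℝⁿ`. -/
def IsFullDimensional {n : ℕ} (C : PointedCone ℝ (Fin n → ℝ)) : Prop :=
  Submodule.span ℝ (C : Set (Fin n → ℝ)) = ⊤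

/-- `R` is the recession cone of `E`: the greatest among the cones that can be translated
into `E`. It exists for every nonempty open convex set `E`, see
`exists_isRecessionCone`. -/
def IsRecessionCone {n : ℕ} (E : Set (Fin n → ℝ)) (R : PointedCone ℝ (Fin n → ℝ)) : Prop :=
  IsGreatest {C | TranslatesInto C E} R

/-- A nonempty open convex set has a recession cone. -/
theorem exists_isRecessionCone {n : ℕ} {E : Set (Fin n → ℝ)} (hc : Convex ℝ E)
    (ho : IsOpen E) (hne : E.Nonempty) : ∃ R, IsRecessionCone E R := by
  let R : PointedCone ℝ (Fin n → ℝ) :=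
    { carrier := {v | ∀ t : ℝ, 0 ≤ t → ∀ x ∈ E, x + t • v ∈ E}
      add_mem' := by
        intro a b ha hb t ht x hx
        have h := hb t ht _ (ha t ht x hx)
        rwa [add_assoc, ← smul_add] at h
      zero_mem' := by
        intro t ht x hx
        simpa using hx
      smul_mem' := by
        intro c v hv t ht x hx
        have h := hv (t * (c : ℝ)) (mul_nonneg ht c.2) x hx
        rwa [mul_smul] at h }
  refine ⟨R, ?_, ?_⟩
  · obtain ⟨x, hx⟩ := hne
    exact ⟨x, fun v hv => by simpa using hv 1 zero_le_one x hx⟩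
  · rintro C ⟨x₀, hC⟩ v hv t ht y hy
    have hcont : Continuous (fun e : ℝ => y + e • (y - x₀)) := by fun_prop
    have hU : IsOpen ((fun e : ℝ => y + e • (y - x₀)) ⁻¹' E) := ho.preimage hcont
    obtain ⟨δ, hδ, hball⟩ := Metric.isOpen_iff.1 hU 0 (by simpa using hy)
    have he : (0 : ℝ) < δ / 2 := by positivity
    have hy' : y + (δ / 2) • (y - x₀) ∈ E :=
      hball (by simp [abs_of_pos hδ]; linarith)
    generalize δ / 2 = e at he hy'
    have hw : x₀ + ((1 + e) / e * t) • v ∈ E := by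
      have hs : 0 ≤ (1 + e) / e * t := by positivity
      exact hC _ (C.smul_mem hs hv)
    have key := hc hy' hw (a := 1 / (1 + e)) (b := e / (1 + e)) (by positivity)
      (by positivity) (by field_simp)
    convert key using 1
    ext i
    simp only [Pi.add_apply, Pi.smul_apply, Pi.sub_apply, smul_eq_mul]
    field_simp
    ring

/-- `E` has a full-dimensional recession cone: a full-dimensional convex cone can be
translated into `E`. Whenever there is a greatest cone that can be translated into `E`,
this says that this greatest cone is full-dimensional, see
`IsRecessionCone.hasFullDimRecessionCone_iff`; it also makes sense for components that
are not convex, which occur when `k` is not algebraically closed. -/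
def HasFullDimRecessionCone {n : ℕ} (E : Set (Fin n → ℝ)) : Prop :=
  ∃ C : PointedCone ℝ (Fin n → ℝ), TranslatesInto C E ∧ IsFullDimensional C

theorem IsRecessionCone.hasFullDimRecessionCone_iff {n : ℕ} {E : Set (Fin n → ℝ)}
    {R : PointedCone ℝ (Fin n → ℝ)} (h : IsRecessionCone E R) :
    HasFullDimRecessionCone E ↔ IsFullDimensional R := by
  constructor
  · rintro ⟨C, hC, hfull⟩
    have hle : C ≤ R := h.2 hC
    exact top_le_iff.1 (hfull.symm.le.trans (Submodule.span_mono hle))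
  · exact fun hR => ⟨R, h.1, hR⟩

/-- A subset `A` of `ℝⁿ` is solid if every connected component of its complement has a
full-dimensional recession cone. -/
def IsSolid {n : ℕ} (A : Set (Fin n → ℝ)) : Prop :=
  ∀ x ∈ Aᶜ, HasFullDimRecessionCone (connectedComponentIn Aᶜ x)

end NonArchAmoeba

end

open scoped Topology

namespace NonArchAmoeba

/-! Where one monomial `α` strictly dominates, the leading terms of `f` cannot cancel, so
`dominanceRegion f α` avoids the amoeba. This region is convex, and each of its points can be moved
along the outer normal cone at `α` without leaving it; that cone is full-dimensional because `α` is
a vertex. It remains to see that the component of any `x` off the amoeba contains such a region.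
Choose `α` maximal at `x`; ties are possible, since `k` need not be algebraically closed. As `α` is
a vertex, some direction `v` breaks all ties in its favour, so a small step along `v` enters the
region of `α` while staying in the open component of `x`. Only the easy half of Kapranov's theorem
is needed. -/

variable {k : Type*} [Field k] {n : ℕ}

/-- The tropical monomial of exponent `α` in `f`: the affine function
`x ↦ -val (coeff α f) + ⟨α, x⟩`. -/
noncomputable def tropMonomial (f : MvPolynomial (Fin n) (Puiseux k)) (α : Fin n →₀ ℕ) (x : Fin n → ℝ) : ℝ :=
  -(((f.coeff α).order : ℚ) : ℝ) + ∑ i, (α i : ℝ) * x i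

theorem tropMonomial_add (f : MvPolynomial (Fin n) (Puiseux k)) (α : Fin n →₀ ℕ)
    (x v : Fin n → ℝ) :
    tropMonomial f α (x + v) = tropMonomial f α x + ∑ i, (α i : ℝ) * v i := by
  simp [tropMonomial, mul_add, Finset.sum_add_distrib, add_assoc]

theorem continuous_tropMonomial (f : MvPolynomial (Fin n) (Puiseux k)) (α : Fin n →₀ ℕ) :
    Continuous (tropMonomial f α) := by
  unfold tropMonomial
  fun_prop

/-- The set of points at which the monomial `α` of `f` dominates all the others strictly. -/
def dominanceRegion (f : MvPolynomial (Fin n) (Puiseux k)) (α : Fin n →₀ ℕ) :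
    Set (Fin n → ℝ) :=
  {x | ∀ β ∈ f.support, β ≠ α → tropMonomial f β x < tropMonomial f α x}

theorem isOpen_dominanceRegion (f : MvPolynomial (Fin n) (Puiseux k)) (α : Fin n →₀ ℕ) :
    IsOpen (dominanceRegion f α) := by
  have h : dominanceRegion f α = ⋂ β ∈ f.support,
      {x | β ≠ α → tropMonomial f β x < tropMonomial f α x} := by
    ext x; simp [dominanceRegion]
  rw [h]
  refine isOpen_biInter_finset fun β _ => ?_
  by_cases hβ : β = α
  · simp [hβ]
  · simpa [hβ] using isOpen_lt (continuous_tropMonomial f β) (continuous_tropMonomial f α)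

theorem convex_dominanceRegion (f : MvPolynomial (Fin n) (Puiseux k)) (α : Fin n →₀ ℕ) :
    Convex ℝ (dominanceRegion f α) := by
  intro x hx y hy a b ha hb hab β hβ hne
  have key : ∀ γ : Fin n →₀ ℕ, tropMonomial f γ (a • x + b • y) =
      a * tropMonomial f γ x + b * tropMonomial f γ y := by
    intro γ
    have hs : ∑ i, (γ i : ℝ) * (a • x + b • y) i =
        a * ∑ i, (γ i : ℝ) * x i + b * ∑ i, (γ i : ℝ) * y i := by
      simp only [Finset.mul_sum, ← Finset.sum_add_distrib]
      refine Finset.sum_congr rfl fun i _ => ?_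
      simp only [Pi.add_apply, Pi.smul_apply, smul_eq_mul]
      ring
    rw [tropMonomial, hs, tropMonomial, tropMonomial]
    linear_combination ((f.coeff γ).order : ℝ) * hab
  rw [key, key]
  have h1 := hx β hβ hne
  have h2 := hy β hβ hne
  -- Strictness is taken from the `x` term, which vanishes when `a = 0`.
  rcases ha.eq_or_lt with rfl | ha
  · obtain rfl : b = 1 := by linarith
    simpa using h2
  · exact add_lt_add_of_lt_of_le (mul_lt_mul_of_pos_left h1 ha)
      (mul_le_mul_of_nonneg_left h2.le hb)

theorem order_prod_pow (z : Fin n → (Puiseux k)ˣ) (β : Fin n →₀ ℕ) (s : Finset (Fin n)) :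
    (∏ i ∈ s, (z i : Puiseux k) ^ β i).order = ∑ i ∈ s, (β i : ℚ) * (z i : Puiseux k).order := by
  classical
  induction s using Finset.induction_on with
  | empty => simp
  | insert a s ha ih =>
    rw [Finset.prod_insert ha, Finset.sum_insert ha, HahnSeries.order_mul, ih,
      HahnSeries.order_pow, nsmul_eq_mul]
    · exact pow_ne_zero _ (z a).ne_zero
    · exact Finset.prod_ne_zero_iff.2 fun i _ => pow_ne_zero _ (z i).ne_zero

theorem order_term (f : MvPolynomial (Fin n) (Puiseux k)) (z : Fin n → (Puiseux k)ˣ)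
    {β : Fin n →₀ ℕ} (hβ : β ∈ f.support) :
    (((f.coeff β * ∏ i, (z i : Puiseux k) ^ β i).order : ℚ) : ℝ) =
      -tropMonomial f β (logMap z) := by
  rw [HahnSeries.order_mul (MvPolynomial.mem_support_iff.1 hβ)
    (Finset.prod_ne_zero_iff.2 fun i _ => pow_ne_zero _ (z i).ne_zero), order_prod_pow]
  simp [tropMonomial, logMap, add_comm]

/-- A zero of `f` in the torus is not mapped to a point where one monomial dominates. -/
theorem logMap_notMem_dominanceRegion {f : MvPolynomial (Fin n) (Puiseux k)}
    {z : Fin n → (Puiseux k)ˣ} (hz : z ∈ hypersurface f) {α : Fin n →₀ ℕ}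
    (hα : α ∈ f.support) : logMap z ∉ dominanceRegion f α := by
  intro hD
  set T : (Fin n →₀ ℕ) → Puiseux k := fun β => f.coeff β * ∏ i, (z i : Puiseux k) ^ β i with hT
  have hsum : ∑ β ∈ f.support, T β = 0 := by
    rw [← MvPolynomial.eval_eq']; exact hz
  have hTα : T α ≠ 0 := mul_ne_zero (MvPolynomial.mem_support_iff.1 hα)
    (Finset.prod_ne_zero_iff.2 fun i _ => pow_ne_zero _ (z i).ne_zero)
  -- At the exponent `(T α).order` only `T α` contributes to the sum: dominance of `α` gives every
  -- other term a larger order.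
  have hc := congrArg (fun s : Puiseux k => s.coeff (T α).order) hsum
  simp only [HahnSeries.coeff_sum, HahnSeries.coeff_zero] at hc
  rw [Finset.sum_eq_single_of_mem α hα] at hc
  · exact HahnSeries.coeff_order_eq_zero.not.2 hTα hc
  · intro β hβ hne
    refine HahnSeries.coeff_eq_zero_of_lt_order ?_
    have := hD β hβ hne
    have h : (((T α).order : ℚ) : ℝ) < (((T β).order : ℚ) : ℝ) := by
      rw [hT, order_term f z hα, order_term f z hβ]
      linarith
    exact_mod_cast h

/-- The region is open, so disjointness from the image of the hypersurface passes to the closure. -/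
theorem dominanceRegion_subset_compl_amoeba (f : MvPolynomial (Fin n) (Puiseux k))
    {α : Fin n →₀ ℕ} (hα : α ∈ f.support) :
    dominanceRegion f α ⊆ (amoeba (hypersurface f))ᶜ := by
  refine Disjoint.subset_compl_right (Disjoint.closure_right ?_ (isOpen_dominanceRegion f α))
  rw [Set.disjoint_right]
  rintro _ ⟨z, hz, rfl⟩
  exact logMap_notMem_dominanceRegion hz hα

/-- The amoeba of the zero polynomial is all of `ℝⁿ`. -/
theorem amoeba_hypersurface_zero :
    amoeba (hypersurface (0 : MvPolynomial (Fin n) (Puiseux k))) = Set.univ := by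
  -- Rational points are dense, and `q` is the image of the point with coordinates `t ^ (-q i)`.
  have hd : DenseRange (fun (q : Fin n → ℚ) (i : Fin n) => ((q i : ℚ) : ℝ)) :=
    DenseRange.piMap fun _ => Rat.denseRange_cast
  refine (hd.mono ?_).closure_eq
  rintro _ ⟨q, rfl⟩
  refine ⟨fun i => Units.mk0 (HahnSeries.single (-q i) 1) (by simp), ?_, ?_⟩
  · simp [hypersurface]
  · ext i
    simp [logMap, HahnSeries.order_single]

theorem exponentPoint_injective : Function.Injective (exponentPoint (n := n)) := by
  intro α β h
  ext i
  exact Nat.cast_injective (R := ℝ) (congrFun h i)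

/-- At a vertex of the Newton polytope some linear form has its strict maximum over the
exponents. -/
theorem exists_forall_sum_lt_of_mem_extremePoints {R : Type*} [CommSemiring R]
    {f : MvPolynomial (Fin n) R} {α : Fin n →₀ ℕ}
    (hα : exponentPoint α ∈ Set.extremePoints ℝ (newtonPolytope f)) :
    ∃ v : Fin n → ℝ, ∀ β ∈ f.support, β ≠ α →
      ∑ i, (β i : ℝ) * v i < ∑ i, (α i : ℝ) * v i := by
  set S : Set (Fin n → ℝ) := exponentPoint '' (f.support : Set (Fin n →₀ ℕ)) with hS
  have hfin : (S \ {exponentPoint α}).Finite := (f.support.finite_toSet.image _).sdiff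
  -- Otherwise the other exponents would already span the polytope, and extreme points of a hull lie
  -- among its generators.
  have hnot : exponentPoint α ∉ convexHull ℝ (S \ {exponentPoint α}) := by
    intro hmem
    have hsub : S ⊆ convexHull ℝ (S \ {exponentPoint α}) := by
      intro p hp
      by_cases h : p = exponentPoint α
      · rwa [h]
      · exact subset_convexHull ℝ _ ⟨hp, h⟩
    have heq : newtonPolytope f = convexHull ℝ (S \ {exponentPoint α}) :=
      (convexHull_min hsub (convex_convexHull ℝ _)).antisymm (convexHull_mono Set.sdiff_subset)
    rw [heq] at hα
    exact (extremePoints_convexHull_subset hα).2 rfl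
  obtain ⟨g, u, hu, hg⟩ := geometric_hahn_banach_point_closed (convex_convexHull ℝ _)
    (hfin.isClosed_convexHull ℝ) hnot
  -- The separating functional `g` is smaller at `α` than at the other exponents, hence the sign in
  -- `v i = -g (Pi.single i 1)`.
  have hgsum : ∀ β : Fin n →₀ ℕ, ∑ i, (β i : ℝ) * -g (Pi.single i 1) = -g (exponentPoint β) := by
    intro β
    have h := LinearMap.pi_apply_eq_sum_univ (g : (Fin n → ℝ) →ₗ[ℝ] ℝ) (exponentPoint β)
    simp only [ContinuousLinearMap.coe_coe, smul_eq_mul] at h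
    rw [h, ← Finset.sum_neg_distrib]
    refine Finset.sum_congr rfl fun i _ => ?_
    rw [mul_neg, exponentPoint]
    congr 4
    ext j
    simp [Pi.single_apply, eq_comm]
  refine ⟨fun i => -g (Pi.single i 1), fun β hβ hne => ?_⟩
  rw [hgsum, hgsum]
  have := hg (exponentPoint β) (subset_convexHull ℝ _
    ⟨⟨β, hβ, rfl⟩, fun h => hne (exponentPoint_injective h)⟩)
  linarith

/-- The outer normal cone at the exponent `α` of the Newton polytope. -/
def normalCone {R : Type*} [CommSemiring R] (f : MvPolynomial (Fin n) R) (α : Fin n →₀ ℕ) :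
    PointedCone ℝ (Fin n → ℝ) where
  carrier := {v | ∀ β ∈ f.support, ∑ i, (β i : ℝ) * v i ≤ ∑ i, (α i : ℝ) * v i}
  add_mem' := by
    intro a b ha hb β hβ
    simpa [mul_add, Finset.sum_add_distrib] using add_le_add (ha β hβ) (hb β hβ)
  zero_mem' := by
    intro β _
    simp
  smul_mem' := by
    intro c v hv β hβ
    have h : ∀ γ : Fin n →₀ ℕ, ∑ i, (γ i : ℝ) * (c • v) i = c * ∑ i, (γ i : ℝ) * v i := by
      intro γ
      rw [Finset.mul_sum]
      refine Finset.sum_congr rfl fun i _ => ?_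
      change (γ i : ℝ) * ((c : ℝ) * v i) = c * (γ i * v i)
      ring
    rw [h, h]
    exact mul_le_mul_of_nonneg_left (hv β hβ) c.2

theorem mem_normalCone {R : Type*} [CommSemiring R] {f : MvPolynomial (Fin n) R}
    {α : Fin n →₀ ℕ} {v : Fin n → ℝ} : v ∈ normalCone f α ↔
      ∀ β ∈ f.support, ∑ i, (β i : ℝ) * v i ≤ ∑ i, (α i : ℝ) * v i :=
  Iff.rfl

/-- The outer normal cone at a vertex is full-dimensional. -/
theorem isFullDimensional_normalCone {R : Type*} [CommSemiring R] {f : MvPolynomial (Fin n) R}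
    {α : Fin n →₀ ℕ} {v : Fin n → ℝ} (hv : ∀ β ∈ f.support, β ≠ α →
      ∑ i, (β i : ℝ) * v i < ∑ i, (α i : ℝ) * v i) :
    IsFullDimensional (normalCone f α) := by
  -- Finitely many strict inequalities persist near `v`, so the cone contains a neighbourhood of
  -- `v`, and no proper subspace does.
  refine Submodule.eq_top_of_nonempty_interior' _ ⟨v, mem_interior_iff_mem_nhds.2 ?_⟩
  have h : ∀ᶠ w in 𝓝 v, ∀ β ∈ f.support,
      ∑ i, (β i : ℝ) * w i ≤ ∑ i, (α i : ℝ) * w i := by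
    rw [Filter.eventually_all_finset]
    intro β hβ
    by_cases hne : β = α
    · simp [hne]
    · have hcont : ∀ γ : Fin n →₀ ℕ, Continuous fun w : Fin n → ℝ => ∑ i, (γ i : ℝ) * w i := by
        intro γ; fun_prop
      filter_upwards [(isOpen_lt (hcont β) (hcont α)).mem_nhds (hv β hβ hne)] with w hw
      exact le_of_lt hw
  exact Filter.mem_of_superset h fun w hw => Submodule.subset_span (mem_normalCone.2 hw)

end NonArchAmoeba

open NonArchAmoeba

theorem theorem2 {k : Type*} [Field k] (n : ℕ) (f : MvPolynomial (Fin n) (Puiseux k))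
    (hf : NonArchAmoeba.IsMaximallySparse f) :
    NonArchAmoeba.IsSolid (NonArchAmoeba.amoeba (NonArchAmoeba.hypersurface f)) := by
  intro x hx
  rcases eq_or_ne f 0 with rfl | hf0
  · rw [amoeba_hypersurface_zero] at hx
    exact absurd (Set.mem_univ x) hx
  obtain ⟨α, hα, hmax⟩ := f.support.exists_max_image (fun β => tropMonomial f β x)
    (MvPolynomial.support_nonempty.2 hf0)
  obtain ⟨v, hv⟩ := exists_forall_sum_lt_of_mem_extremePoints (hf α hα)
  -- Weak maximality at `x` plus strict growth along `v` gives strict dominance for every `t > 0`.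
  have hray : ∀ t : ℝ, 0 < t → x + t • v ∈ dominanceRegion f α := by
    intro t ht β hβ hne
    have h : ∀ γ : Fin n →₀ ℕ, ∑ i, (γ i : ℝ) * (t • v) i = t * ∑ i, (γ i : ℝ) * v i := by
      intro γ
      rw [Finset.mul_sum]
      refine Finset.sum_congr rfl fun i _ => ?_
      rw [Pi.smul_apply, smul_eq_mul]
      ring
    rw [tropMonomial_add, tropMonomial_add, h, h]
    exact add_lt_add_of_le_of_lt (hmax β hβ) (mul_lt_mul_of_pos_left (hv β hβ hne) ht)
  have hopen : IsOpen (connectedComponentIn (amoeba (hypersurface f))ᶜ x) :=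
    isClosed_closure.isOpen_compl.connectedComponentIn
  have hcont : Filter.Tendsto (fun t : ℝ => x + t • v) (𝓝[>] 0) (𝓝 x) := by
    have h : Continuous fun t : ℝ => x + t • v := by fun_prop
    simpa using (h.tendsto 0).mono_left nhdsWithin_le_nhds
  obtain ⟨t, hmem, ht⟩ := ((hcont.eventually
    (hopen.mem_nhds (mem_connectedComponentIn hx))).and self_mem_nhdsWithin).exists
  have hsub : dominanceRegion f α ⊆ connectedComponentIn (amoeba (hypersurface f))ᶜ x := by
    -- The component is rebased at `x + t • v`, since `x` itself may lie outside the dominance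
    -- region.
    rw [connectedComponentIn_eq hmem]
    exact (convex_dominanceRegion f α).isPreconnected.subset_connectedComponentIn
      (hray t ht) (dominanceRegion_subset_compl_amoeba f hα)
  refine ⟨normalCone f α, ⟨x + t • v, fun w hw => hsub fun β hβ hne => ?_⟩,
    isFullDimensional_normalCone hv⟩
  rw [tropMonomial_add, tropMonomial_add f α]
  exact add_lt_add_of_lt_of_le (hray t ht β hβ hne) (mem_normalCone.1 hw β hβ)
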